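/- Let $E$ be a (real) Banach lattice with dual Banach lattice $E^*$ (ordered by $f\le g$ iff $f(x)\le g(x)$ for all $x\ge 0$ in $E$), and let $1\le p<\infty$ be a real number. A sequence $(v_n)_n$ in $E$ or $E^*$ is disjoint if $|v_m|\wedge|v_n|=0$ whenever $m\ne n$. A sequence $(x_n)_n$ in $E$ is weakly $p$-summable if $\sum_n |x^*(x_n)|^p<\infty$ for every $x^*\in E^*$. A set $A\subseteq E$ is Dunford--Pettis if every weakly null sequence $(x_n^*)_n$ in $E^*$ converges to $0$ uniformly on $A$, and a bounded set $A\subseteq E$ is almost Dunford--Pettis if every disjoint weakly null sequence in $E^*$ converges to $0$ uniformly on $A$; a sequence $(x_n)_n$ has one of these properties if the set $\{x_n : n\in\mathbb N\}$ has it. Then the following are equivalent. (a) $E$ has the disjoint Dunford--Pettis property of order $p$ (disjoint $DPP_p$): every disjoint weakly $p$-summable sequence in $E$ is Dunford--Pettis. (b) Every disjoint weakly $p$-summable sequence in $E$ is almost Dunford--Pettis. (c) For every disjoint weakly $p$-summable sequence $(x_n)_n$ in $E$ and every disjoint weakly null sequence $(x_n^*)_n$ in $E^*$, we have $x_n^*(x_n)\to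 0$. (d) For every disjoint weakly $p$-summable sequence $(x_n)_n$ in $E$ and every positive disjoint weakly null sequence $(x_n^*)_n$ in $E^*$, we have $x_n^*(x_n)\to 0$. (e) For every disjoint weakly $p$-summable sequence $(x_n)_n$ in $E$ and every positive weakly null sequence $(x_n^*)_n$ in $E^*$, we have $x_n^*(x_n)\to 0$. -/

import Mathlib

namespace BanachLattice

open Filter Topology

section Dual

variable {E : Type*} [NormedAddCommGroup E] [Lattice E] [HasSolidNorm E] [IsOrderedAddMonoid E]
  [NormedSpace ℝ E]

/-- The value at `x ≥ 0` of the positive part of `f`, by the Riesz–Kantorovich formula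
`f⁺(x) = sup {f y : 0 ≤ y ≤ x}`. -/
noncomputable def posVal (f : StrongDual ℝ E) (x : E) : ℝ := sSup (f '' Set.Icc 0 x)

theorem norm_le_of_nonneg_le {F : Type*} [NormedAddCommGroup F] [Lattice F] [HasSolidNorm F]
    [IsOrderedAddMonoid F] {x y : F} (hy : 0 ≤ y) (hyx : y ≤ x) : ‖y‖ ≤ ‖x‖ := by
  apply norm_le_norm_of_abs_le_abs
  rwa [abs_of_nonneg hy, abs_of_nonneg (hy.trans hyx)]

theorem apply_le_bound (f : StrongDual ℝ E) {x y : E} (hy : y ∈ Set.Icc 0 x) :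
    f y ≤ ‖f‖ * ‖x‖ :=
  ((le_abs_self _).trans (f.le_opNorm y)).trans
    (mul_le_mul_of_nonneg_left (norm_le_of_nonneg_le hy.1 hy.2) (norm_nonneg _))

theorem bddAbove_image (f : StrongDual ℝ E) (x : E) : BddAbove (f '' Set.Icc 0 x) := by
  refine ⟨‖f‖ * ‖x‖, ?_⟩
  rintro _ ⟨y, hy, rfl⟩
  exact apply_le_bound f hy

theorem apply_le_posVal (f : StrongDual ℝ E) {x y : E} (hy : y ∈ Set.Icc 0 x) :
    f y ≤ posVal f x :=
  le_csSup (bddAbove_image f x) ⟨y, hy, rfl⟩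

theorem posVal_le (f : StrongDual ℝ E) {x : E} (hx : 0 ≤ x) {c : ℝ}
    (h : ∀ y ∈ Set.Icc 0 x, f y ≤ c) : posVal f x ≤ c := by
  refine csSup_le ⟨f 0, 0, ⟨le_rfl, hx⟩, rfl⟩ ?_
  rintro _ ⟨y, hy, rfl⟩
  exact h y hy

theorem posVal_nonneg (f : StrongDual ℝ E) {x : E} (hx : 0 ≤ x) : 0 ≤ posVal f x := by
  simpa using apply_le_posVal f (x := x) (y := 0) ⟨le_rfl, hx⟩

theorem posVal_le_bound (f : StrongDual ℝ E) {x : E} (hx : 0 ≤ x) :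
    posVal f x ≤ ‖f‖ * ‖x‖ :=
  posVal_le f hx fun _ hy => apply_le_bound f hy

theorem posVal_add (f : StrongDual ℝ E) {x y : E} (hx : 0 ≤ x) (hy : 0 ≤ y) :
    posVal f (x + y) = posVal f x + posVal f y := by
  apply le_antisymm
  · refine posVal_le f (add_nonneg hx hy) fun z hz => ?_
    have h1 : z ⊓ x ∈ Set.Icc 0 x := ⟨le_inf hz.1 hx, inf_le_right⟩
    have h2 : z - z ⊓ x ∈ Set.Icc 0 y := by
      refine ⟨sub_nonneg.2 inf_le_left, ?_⟩
      rw [sub_le_iff_le_add, ← sub_le_iff_le_add']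
      exact le_inf (sub_le_self _ hy) (sub_le_iff_le_add.2 hz.2)
    have h3 : f z = f (z ⊓ x) + f (z - z ⊓ x) := by rw [← map_add]; congr 1; abel
    rw [h3]
    exact add_le_add (apply_le_posVal f h1) (apply_le_posVal f h2)
  · rw [← le_sub_iff_add_le]
    refine posVal_le f hx fun a ha => ?_
    rw [le_sub_comm]
    refine posVal_le f hy fun b hb => ?_
    rw [le_sub_iff_add_le', ← map_add]
    exact apply_le_posVal f ⟨add_nonneg ha.1 hb.1, add_le_add ha.2 hb.2⟩

theorem posVal_posPart_sub (f : StrongDual ℝ E) {a b : E} (ha : 0 ≤ a) (hb : 0 ≤ b) :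
    posVal f (a - b)⁺ - posVal f (a - b)⁻ = posVal f a - posVal f b := by
  have h : (a - b)⁺ + b = a + (a - b)⁻ := by
    have := posPart_sub_negPart (a - b)
    rw [sub_eq_sub_iff_add_eq_add] at this
    exact this
  have h' := congrArg (posVal f) h
  rw [posVal_add f (posPart_nonneg _) hb, posVal_add f ha (negPart_nonneg _)] at h'
  linarith

/-- The additive extension of `posVal f` from the positive cone to the whole space. -/
noncomputable def posHom (f : StrongDual ℝ E) : E →+ ℝ :=
  AddMonoidHom.mk' (fun x => posVal f x⁺ - posVal f x⁻) fun x y => by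
    have h : x + y = (x⁺ + y⁺) - (x⁻ + y⁻) := by
      rw [add_sub_add_comm, posPart_sub_negPart, posPart_sub_negPart]
    have h' := posVal_posPart_sub f (add_nonneg (posPart_nonneg x) (posPart_nonneg y))
      (add_nonneg (negPart_nonneg x) (negPart_nonneg y))
    rw [← h, posVal_add f (posPart_nonneg x) (posPart_nonneg y),
      posVal_add f (negPart_nonneg x) (negPart_nonneg y)] at h'
    rw [h']
    ring

theorem posHom_apply (f : StrongDual ℝ E) (x : E) :
    posHom f x = posVal f x⁺ - posVal f x⁻ := rfl

theorem posHom_bound (f : StrongDual ℝ E) (x : E) : ‖posHom f x‖ ≤ ‖f‖ * ‖x‖ := by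
  have e1 : ‖x⁺‖ ≤ ‖x‖ := by
    rw [← norm_abs_eq_norm x]
    exact norm_le_of_nonneg_le (posPart_nonneg x) (sup_le (le_abs_self x) (abs_nonneg x))
  have e2 : ‖x⁻‖ ≤ ‖x‖ := by
    rw [← norm_abs_eq_norm x]
    exact norm_le_of_nonneg_le (negPart_nonneg x) (sup_le (neg_le_abs x) (abs_nonneg x))
  have a1 := (posVal_le_bound f (posPart_nonneg x)).trans
    (mul_le_mul_of_nonneg_left e1 (norm_nonneg f))
  have a2 := (posVal_le_bound f (negPart_nonneg x)).trans
    (mul_le_mul_of_nonneg_left e2 (norm_nonneg f))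
  have b1 := posVal_nonneg f (posPart_nonneg x)
  have b2 := posVal_nonneg f (negPart_nonneg x)
  rw [posHom_apply, Real.norm_eq_abs, abs_le]
  constructor <;> linarith

/-- The positive part `f⁺` of a continuous functional `f`, as a continuous functional. -/
noncomputable def dualPosPart (f : StrongDual ℝ E) : StrongDual ℝ E :=
  (posHom f).toRealLinearMap (AddMonoidHomClass.continuous_of_bound (posHom f) ‖f‖ (posHom_bound f))

theorem dualPosPart_apply (f : StrongDual ℝ E) {x : E} (hx : 0 ≤ x) :
    dualPosPart f x = posVal f x := by
  have h0 : posVal f (0 : E) = 0 := by simp [posVal]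
  change posHom f x = _
  rw [posHom_apply, posPart_of_nonneg hx, negPart_of_nonneg hx, h0, sub_zero]

/-- The lattice structure of the dual `E*` of a Banach lattice: `f ≤ g` means `f x ≤ g x` for all
`x ≥ 0`; the suprema and infima of this order are `f ⊔ g = f + (g - f)⁺` and
`f ⊓ g = g - (g - f)⁺`. -/
@[reducible] noncomputable def dualLattice : Lattice (StrongDual ℝ E) where
  le f g := ∀ x : E, 0 ≤ x → f x ≤ g x
  le_refl _ _ _ := le_rfl
  le_trans _ _ _ h₁ h₂ x hx := (h₁ x hx).trans (h₂ x hx)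
  le_antisymm f g h₁ h₂ := by
    ext x
    rw [← posPart_sub_negPart x, map_sub, map_sub,
      le_antisymm (h₁ _ (posPart_nonneg x)) (h₂ _ (posPart_nonneg x)),
      le_antisymm (h₁ _ (negPart_nonneg x)) (h₂ _ (negPart_nonneg x))]
  sup f g := f + dualPosPart (g - f)
  inf f g := g - dualPosPart (g - f)
  le_sup_left f g x hx := by
    simpa [dualPosPart_apply _ hx] using posVal_nonneg (g - f) hx
  le_sup_right f g x hx := by
    have := apply_le_posVal (g - f) (x := x) (y := x) ⟨hx, le_rfl⟩
    simp only [add_apply, sub_apply,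
      dualPosPart_apply _ hx] at this ⊢
    linarith
  sup_le f g k h₁ h₂ x hx := by
    have : posVal (g - f) x ≤ k x - f x := posVal_le _ hx fun y hy => by
      have e₁ := h₁ (x - y) (sub_nonneg.2 hy.2)
      have e₂ := h₂ y hy.1
      simp only [map_sub, sub_apply] at e₁ ⊢
      linarith
    simp only [add_apply, dualPosPart_apply _ hx]
    linarith
  inf_le_left f g x hx := by
    have := apply_le_posVal (g - f) (x := x) (y := x) ⟨hx, le_rfl⟩
    simp only [sub_apply, dualPosPart_apply _ hx] at this ⊢
    linarith
  inf_le_right f g x hx := by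
    simpa [dualPosPart_apply _ hx] using posVal_nonneg (g - f) hx
  le_inf k f g h₁ h₂ x hx := by
    have : posVal (g - f) x ≤ g x - k x := posVal_le _ hx fun y hy => by
      have e₁ := h₁ y hy.1
      have e₂ := h₂ (x - y) (sub_nonneg.2 hy.2)
      simp only [map_sub, sub_apply] at e₂ ⊢
      linarith
    simp only [sub_apply, dualPosPart_apply _ hx]
    linarith

end Dual

/-- A sequence in a lattice-ordered group is disjoint if `|x m| ⊓ |x n| = 0` whenever `m ≠ n`. -/
def IsDisjointSeq {V : Type*} [Lattice V] [AddCommGroup V] (x : ℕ → V) : Prop :=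
  ∀ m n, m ≠ n → |x m| ⊓ |x n| = 0

/-- Convergence to `0` in the weak topology of a normed space. -/
def IsWeaklyNull {X : Type*} [NormedAddCommGroup X] [NormedSpace ℝ X] (x : ℕ → X) : Prop :=
  Tendsto (fun n => toWeakSpace ℝ X (x n)) atTop (𝓝 0)

/-- `(x n)` is weakly `p`-summable if `(f (x n))` is in `ℓ_p` for every `f` in the dual. -/
def IsWeaklyPSummable {X : Type*} [NormedAddCommGroup X] [NormedSpace ℝ X] (p : ℝ)
    (x : ℕ → X) : Prop :=
  ∀ f : StrongDual ℝ X, Summable fun n => |f (x n)| ^ p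

/-- Every weakly null sequence in the dual converges to `0` uniformly on `A`. -/
def IsDunfordPettisSet {X : Type*} [NormedAddCommGroup X] [NormedSpace ℝ X] (A : Set X) : Prop :=
  ∀ f : ℕ → StrongDual ℝ X, IsWeaklyNull f →
    TendstoUniformlyOn (fun n x => f n x) (fun _ => 0) atTop A

section Lattice

variable {E : Type*} [NormedAddCommGroup E] [Lattice E] [HasSolidNorm E] [IsOrderedAddMonoid E]
  [NormedSpace ℝ E]

/-- A sequence in the dual `E*` that is disjoint for the lattice structure of `E*`. -/
def IsDisjointDualSeq (f : ℕ → StrongDual ℝ E) : Prop :=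
  @IsDisjointSeq (StrongDual ℝ E) dualLattice _ f

/-- A sequence of positive elements of the dual lattice `E*`. -/
def IsPositiveDualSeq (f : ℕ → StrongDual ℝ E) : Prop :=
  letI : Lattice (StrongDual ℝ E) := dualLattice
  ∀ n, 0 ≤ f n

/-- `A` is bounded and every disjoint weakly null sequence in the dual converges to `0`
uniformly on `A`. -/
def IsAlmostDunfordPettisSet (A : Set E) : Prop :=
  Bornology.IsBounded A ∧
    ∀ f : ℕ → StrongDual ℝ E, IsDisjointDualSeq f → IsWeaklyNull f →
      TendstoUniformlyOn (fun n x => f n x) (fun _ => 0) atTop A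

end Lattice

/-- The disjoint Dunford–Pettis property of order `p`. -/
def HasDisjointDPP (E : Type*) [NormedAddCommGroup E] [Lattice E] [NormedSpace ℝ E]
    (p : ℝ) : Prop :=
  ∀ x : ℕ → E, IsDisjointSeq x → IsWeaklyPSummable p x → IsDunfordPettisSet (Set.range x)

end BanachLattice

/-!
The main step is that (d) implies (a). Let `f n` be weakly null in `E*` and `x n` disjoint in `E`.
The component `w n` of `(f n)⁺` on the band generated by `x n` satisfies `w n (x n) = (f n)⁺ (x n)`,
and the `w n` are positive and disjoint. They are also weakly null: for `φ ≥ 0` in `E**`, the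
components `H n` of `φ` on the bands of the `w n` have partial sums below `φ`, and
`φ (w n) = H n (w n) ≤ H n (f n)`. Since `∑ k ∈ S, H k` is a functional for every `S ⊆ ℕ`, all
subseries of the rows of the matrix `H k (f n)` tend to zero, and hence so does its diagonal, by a
theorem of Phillips type. Thus (d) yields `(f n)⁺ (x n) → 0`, and uniform convergence on the range
of `x` reduces to such diagonals along subsequences.
-/

namespace BanachLattice

open Filter Topology

section UniformConvergence

variable {α β : Type*} [UniformSpace β] {F : ℕ → α → β} {c : β} {x : ℕ → α}

theorem tendsto_diag_of_tendstoUniformlyOn_range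
    (h : TendstoUniformlyOn F (fun _ => c) atTop (Set.range x)) :
    Tendsto (fun n => F n (x n)) atTop (𝓝 c) :=
  Uniform.tendsto_nhds_right.2 fun u hu => (h u hu).mono fun n hn => hn _ (Set.mem_range_self n)

theorem tendstoUniformlyOn_range_of_tendsto_diag
    (hpt : ∀ m, Tendsto (fun n => F n (x m)) atTop (𝓝 c))
    (hdiag : ∀ n m : ℕ → ℕ, StrictMono n → StrictMono m →
      Tendsto (fun j => F (n j) (x (m j))) atTop (𝓝 c)) :
    TendstoUniformlyOn F (fun _ => c) atTop (Set.range x) := by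
  intro u hu
  by_contra hfreq
  obtain ⟨n, hn, hbad⟩ := extraction_of_frequently_atTop (not_eventually.1 hfreq)
  simp only [Set.forall_mem_range, not_forall] at hbad
  choose m hm using hbad
  suffices ∃ g : ℕ → ℕ, Tendsto (fun j => F (n (g j)) (x (m (g j)))) atTop (𝓝 c) by
    obtain ⟨g, hg⟩ := this
    obtain ⟨j, hj⟩ := (Uniform.tendsto_nhds_right.1 hg |>.eventually hu).exists
    exact hm _ hj
  obtain ⟨g, hinc | hdec⟩ := exists_increasing_or_nonincreasing_subseq (· < ·) m
  · exact ⟨g, hdiag (n ∘ g) (m ∘ g) (hn.comp g.strictMono) fun i j => hinc i j⟩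
  · have hanti : Antitone (m ∘ g) := antitone_nat_of_succ_le fun j =>
      not_lt.1 (hdec j (j + 1) j.lt_succ_self)
    obtain ⟨N, hN⟩ := WellFoundedLT.antitone_chain_condition hanti
    refine ⟨g, ((hpt (m (g N))).comp (hn.comp g.strictMono).tendsto_atTop).congr' ?_⟩
    filter_upwards [eventually_ge_atTop N] with j hj
    exact congrArg (fun i => F (n (g j)) (x i)) (hN j hj)

end UniformConvergence

section Subseries

variable {G : Type*} [NormedAddCommGroup G] [CompleteSpace G]

theorem continuous_tsum_indicator {a : ℕ → G} (ha : Summable fun k => ‖a k‖) :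
    Continuous fun b : ℕ → Bool => ∑' k, {k | b k}.indicator a k := by
  refine continuous_tsum (fun k => ?_) ha fun k b => norm_indicator_le_norm_self _ _
  have hdigit : (fun b : ℕ → Bool => {k | b k}.indicator a k) =
      (fun t : Bool => if t then a k else 0) ∘ fun b => b k := by
    ext b
    simp [Set.indicator]
  rw [hdigit]
  exact continuous_of_discreteTopology.comp (continuous_apply k)

theorem tsum_indicator_update_sub {a : ℕ → G} (ha : Summable a) (b : ℕ → Bool) (n : ℕ) :
    ∑' k, {k | Function.update b n true k}.indicator a k -
      ∑' k, {k | Function.update b n false k}.indicator a k = a n := by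
  rw [← (ha.indicator _).tsum_sub (ha.indicator _), tsum_eq_single n]
  · simp
  · intro k hk
    simp [Set.indicator, Function.update_of_ne hk]

-- By Baire, the subseries are uniformly small on a cylinder of `ℕ → Bool`; for large `n`, both
-- choices of the `n`-th digit stay in that cylinder, and the two subseries differ by `a n n`.
theorem tendsto_diag_of_tendsto_subseries {a : ℕ → ℕ → G} (ha : ∀ n, Summable fun k => ‖a n k‖)
    (hS : ∀ S : Set ℕ, Tendsto (fun n => ∑' k : S, a n k) atTop (𝓝 0)) :
    Tendsto (fun n => a n n) atTop (𝓝 0) := by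
  simp only [tsum_subtype] at hS
  rw [NormedAddGroup.tendsto_nhds_zero]
  intro ε hε
  let C (N : ℕ) : Set (ℕ → Bool) :=
    ⋂ n ≥ N, {b | ‖∑' k, {k | b k}.indicator (a n) k‖ ≤ ε / 3}
  have hC (N : ℕ) : IsClosed (C N) := isClosed_biInter fun n _ =>
    isClosed_le (continuous_tsum_indicator (ha n)).norm continuous_const
  have hcover : ⋃ N, C N = Set.univ := Set.eq_univ_of_forall fun b => by
    obtain ⟨N, hN⟩ := eventually_atTop.1
      ((NormedAddGroup.tendsto_nhds_zero.1 (hS {k | b k})) (ε / 3) (by positivity))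
    exact Set.mem_iUnion.2 ⟨N, Set.mem_iInter₂.2 fun n hn => (hN n hn).le⟩
  obtain ⟨N, b, hb⟩ := nonempty_interior_of_iUnion_of_closed hC hcover
  obtain ⟨_, ⟨b, K, rfl⟩, -, hK⟩ :=
    (PiNat.isTopologicalBasis_cylinders fun _ => Bool).mem_nhds_iff.1
      (mem_interior_iff_mem_nhds.1 hb)
  filter_upwards [eventually_ge_atTop N, eventually_ge_atTop K] with n hN hnK
  have hsmall (t : Bool) :
      ‖∑' k, {k | Function.update b n t k}.indicator (a n) k‖ ≤ ε / 3 :=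
    Set.mem_iInter₂.1 (hK (PiNat.cylinder_anti b hnK (PiNat.update_mem_cylinder b n t))) n hN
  calc ‖a n n‖ ≤ ε / 3 + ε / 3 := by
        rw [← tsum_indicator_update_sub (ha n).of_norm b n]
        exact norm_sub_le_of_le (hsmall true) (hsmall false)
    _ < ε := by linarith

end Subseries

section LatticeGroup

variable {V : Type*} [AddCommGroup V] [Lattice V] [IsOrderedAddMonoid V]

theorem add_inf_le_inf_add_inf {a b c : V} (ha : 0 ≤ a) (hb : 0 ≤ b) (hc : 0 ≤ c) :
    (a + b) ⊓ c ≤ a ⊓ c + b ⊓ c := by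
  rw [inf_add, add_inf, add_inf]
  exact le_inf (le_inf inf_le_left (inf_le_right.trans (le_add_of_nonneg_left ha)))
    (le_inf (inf_le_right.trans (le_add_of_nonneg_right hb))
      (inf_le_right.trans (le_add_of_nonneg_right hc)))

theorem add_inf_eq_zero {a b c : V} (ha : 0 ≤ a) (hb : 0 ≤ b) (hc : 0 ≤ c) (hac : a ⊓ c = 0)
    (hbc : b ⊓ c = 0) : (a + b) ⊓ c = 0 := by
  refine le_antisymm ?_ (le_inf (add_nonneg ha hb) hc)
  simpa only [hac, hbc, add_zero] using add_inf_le_inf_add_inf ha hb hc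

theorem sum_inf_eq_zero {ι : Type*} {s : Finset ι} {a : ι → V} {c : V} (ha : ∀ i ∈ s, 0 ≤ a i)
    (hc : 0 ≤ c) (hac : ∀ i ∈ s, a i ⊓ c = 0) : (∑ i ∈ s, a i) ⊓ c = 0 := by
  refine (Finset.sum_induction a (fun v => 0 ≤ v ∧ v ⊓ c = 0) (fun v w hv hw => ?_) ?_
    fun i hi => ⟨ha i hi, hac i hi⟩).2
  · exact ⟨add_nonneg hv.1 hw.1, add_inf_eq_zero hv.1 hw.1 hc hv.2 hw.2⟩
  · exact ⟨le_rfl, inf_eq_left.2 hc⟩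

theorem nsmul_inf_eq_zero {a c : V} (ha : 0 ≤ a) (hc : 0 ≤ c) (hac : a ⊓ c = 0) (k : ℕ) :
    (k • a) ⊓ c = 0 := by
  simpa using sum_inf_eq_zero (s := Finset.range k) (fun _ _ => ha) hc fun _ _ => hac

theorem nsmul_inf_nsmul_eq_zero {a c : V} (ha : 0 ≤ a) (hc : 0 ≤ c) (hac : a ⊓ c = 0)
    (k l : ℕ) : (k • a) ⊓ (l • c) = 0 := by
  rw [inf_comm]
  exact nsmul_inf_eq_zero hc (nsmul_nonneg ha k) (by rw [inf_comm, nsmul_inf_eq_zero ha hc hac]) l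

theorem sum_le_of_pairwise_inf_eq_zero {ι : Type*} {s : Finset ι} {a : ι → V} {y : V}
    (hy : 0 ≤ y) (ha : ∀ i ∈ s, a i ∈ Set.Icc 0 y)
    (hd : (s : Set ι).Pairwise fun i j => a i ⊓ a j = 0) : ∑ i ∈ s, a i ≤ y := by
  classical
  induction s using Finset.induction_on with
  | empty => simpa using hy
  | insert i s hi ih =>
    rw [Finset.forall_mem_insert] at ha
    rw [Finset.coe_insert] at hd
    have hdisj : a i ⊓ ∑ j ∈ s, a j = 0 := by
      rw [inf_comm]
      exact sum_inf_eq_zero (fun j hj => (ha.2 j hj).1) ha.1.1 fun j hj =>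
        hd (Set.mem_insert_of_mem i hj) (Set.mem_insert i _) (ne_of_mem_of_not_mem hj hi)
    rw [Finset.sum_insert hi, ← inf_add_sup, hdisj, zero_add]
    exact sup_le ha.1.2 (ih ha.2 (hd.mono (Set.subset_insert i _)))

end LatticeGroup

section WeakSequences

variable {X : Type*} [NormedAddCommGroup X] [NormedSpace ℝ X]

theorem isWeaklyNull_iff {x : ℕ → X} :
    IsWeaklyNull x ↔ ∀ φ : StrongDual ℝ X, Tendsto (fun n => φ (x n)) atTop (𝓝 0) := by
  have hinj : Function.Injective (topDualPairing ℝ X).flip := fun a b hab =>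
    (SeparatingDual.eq_iff_forall_dual_eq (R := ℝ)).2 fun φ => LinearMap.congr_fun hab φ
  refine (WeakBilin.tendsto_iff_forall_eval_tendsto _ hinj).trans (forall_congr' fun φ => ?_)
  have h0 : (topDualPairing ℝ X).flip 0 φ = 0 := map_zero φ
  exact iff_of_eq (congrArg (fun c => Tendsto (fun n => φ (x n)) atTop (𝓝 c)) h0)

theorem IsWeaklyNull.comp {x : ℕ → X} (hx : IsWeaklyNull x) {n : ℕ → ℕ}
    (hn : Tendsto n atTop atTop) : IsWeaklyNull (x ∘ n) :=
  Tendsto.comp (f := n) hx hn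

theorem IsWeaklyNull.neg {x : ℕ → X} (hx : IsWeaklyNull x) : IsWeaklyNull (-x) :=
  isWeaklyNull_iff.2 fun φ => by simpa using (isWeaklyNull_iff.1 hx φ).neg

theorem IsWeaklyNull.tendsto_apply {f : ℕ → StrongDual ℝ X} (hf : IsWeaklyNull f) (x : X) :
    Tendsto (fun n => f n x) atTop (𝓝 0) :=
  isWeaklyNull_iff.1 hf (NormedSpace.inclusionInDoubleDual ℝ X x)

theorem IsWeaklyPSummable.comp {p : ℝ} {x : ℕ → X} (hx : IsWeaklyPSummable p x) {n : ℕ → ℕ}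
    (hn : Function.Injective n) : IsWeaklyPSummable p (x ∘ n) :=
  fun f => (hx f).comp_injective hn

theorem IsWeaklyPSummable.isBounded_range {p : ℝ} (hp : 0 < p) {x : ℕ → X}
    (hx : IsWeaklyPSummable p x) : Bornology.IsBounded (Set.range x) := by
  obtain ⟨C, hC⟩ := banach_steinhaus (g := fun n => NormedSpace.inclusionInDoubleDual ℝ X (x n))
    fun f => by
      obtain ⟨B, hB⟩ := (hx f).tendsto_atTop_zero.bddAbove_range
      refine ⟨B ^ p⁻¹, fun n => ?_⟩
      have h : |f (x n)| ^ p ≤ B := hB ⟨n, rfl⟩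
      exact (Real.le_rpow_inv_iff_of_pos (abs_nonneg _)
        ((Real.rpow_nonneg (abs_nonneg _) p).trans h) hp).2 h
  refine isBounded_iff_forall_norm_le.2 ⟨C, Set.forall_mem_range.2 fun n => ?_⟩
  exact ((NormedSpace.inclusionInDoubleDualLi ℝ (E := X)).norm_map (x n)).symm.trans_le (hC n)

theorem IsDisjointSeq.comp {V : Type*} [Lattice V] [AddCommGroup V] {x : ℕ → V}
    (hx : IsDisjointSeq x) {n : ℕ → ℕ} (hn : Function.Injective n) : IsDisjointSeq (x ∘ n) :=
  fun _ _ hij => hx _ _ (hn.ne hij)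

end WeakSequences

variable {E : Type*} [NormedAddCommGroup E] [Lattice E] [NormedSpace ℝ E]

/-- For `u ≥ 0` and a positive functional `f`, the functional `h` is the component of `f` carried
by the band generated by `u`. The elements `y ⊓ k • u` increase to the band projection of `y ≥ 0`
whenever it exists in `E`; the limit below makes sense in any normed lattice. -/
def IsBandComponent (f : StrongDual ℝ E) (u : E) (h : StrongDual ℝ E) : Prop :=
  ∀ y, 0 ≤ y → Tendsto (fun k : ℕ => f (y ⊓ k • u)) atTop (𝓝 (h y))

section BandComponent

variable [IsOrderedAddMonoid E] {f h : StrongDual ℝ E} {u x y : E}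

namespace IsBandComponent

theorem apply_eq_of_le_nsmul (hh : IsBandComponent f u h) (hu : 0 ≤ u) (hy : 0 ≤ y) {j : ℕ}
    (hyu : y ≤ j • u) : h y = f y := by
  refine tendsto_nhds_unique (hh y hy) (tendsto_const_nhds.congr' ?_)
  filter_upwards [eventually_ge_atTop j] with i hi
  rw [inf_eq_left.2 (hyu.trans (nsmul_le_nsmul_left hu hi))]

theorem apply_eq_of_abs (hh : IsBandComponent f |x| h) : h x = f x := by
  have hIcc {y : E} (hy : 0 ≤ y) (hyx : y ≤ |x|) : h y = f y :=
    hh.apply_eq_of_le_nsmul (abs_nonneg x) hy (j := 1) (by rwa [one_nsmul])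
  rw [← posPart_sub_negPart x, map_sub, map_sub,
    hIcc (posPart_nonneg x) (sup_le (le_abs_self x) (abs_nonneg x)),
    hIcc (negPart_nonneg x) (sup_le (neg_le_abs x) (abs_nonneg x))]

theorem apply_eq_zero (hh : IsBandComponent f u h) (hu : 0 ≤ u) (hy : 0 ≤ y) (hyu : u ⊓ y = 0) :
    h y = 0 := by
  refine tendsto_nhds_unique (hh y hy) (tendsto_const_nhds.congr fun k => ?_)
  rw [inf_comm, nsmul_inf_eq_zero hu hy hyu, map_zero]

end IsBandComponent

end BandComponent

section DualLattice

variable [HasSolidNorm E] [IsOrderedAddMonoid E]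

theorem exists_dual_eq_on_nonneg {g : E → ℝ} {c : ℝ}
    (hadd : ∀ y z, 0 ≤ y → 0 ≤ z → g (y + z) = g y + g z)
    (hnonneg : ∀ y, 0 ≤ y → 0 ≤ g y) (hbound : ∀ y, 0 ≤ y → g y ≤ c * ‖y‖) :
    ∃ h : StrongDual ℝ E, ∀ y, 0 ≤ y → h y = g y := by
  have hzero : g 0 = 0 := by simpa using hadd 0 0 le_rfl le_rfl
  let H : E →+ ℝ := AddMonoidHom.mk' (fun x => g x⁺ - g x⁻) fun x y => by
    have h : (x + y)⁺ + (x⁻ + y⁻) = (x⁺ + y⁺) + (x + y)⁻ := by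
      rw [← sub_eq_sub_iff_add_eq_add, posPart_sub_negPart, add_sub_add_comm,
        posPart_sub_negPart, posPart_sub_negPart]
    have hg := congrArg g h
    simp only [hadd, posPart_nonneg, negPart_nonneg, add_nonneg] at hg
    linarith
  have hH (x : E) : ‖H x‖ ≤ c * ‖x‖ := by
    have hpos := hnonneg _ (posPart_nonneg x)
    have hneg := hnonneg _ (negPart_nonneg x)
    calc ‖g x⁺ - g x⁻‖ ≤ g x⁺ + g x⁻ := abs_le.2 ⟨by linarith, by linarith⟩
      _ = g |x| := by rw [← hadd _ _ (posPart_nonneg x) (negPart_nonneg x), posPart_add_negPart]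
      _ ≤ c * ‖x‖ := norm_abs_eq_norm x ▸ hbound _ (abs_nonneg x)
  refine ⟨H.toRealLinearMap (AddMonoidHomClass.continuous_of_bound H c hH), fun y hy => ?_⟩
  change g y⁺ - g y⁻ = g y
  rw [posPart_of_nonneg hy, negPart_of_nonneg hy, hzero, sub_zero]

attribute [local instance] dualLattice

local instance dual_isOrderedAddMonoid : IsOrderedAddMonoid (StrongDual ℝ E) where
  add_le_add_left _ _ h k x hx := add_le_add_left (h x hx) (k x)

theorem monotone_of_dual_nonneg {f : StrongDual ℝ E} (hf : 0 ≤ f) : Monotone f := fun y z h => by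
  simpa using hf (z - y) (sub_nonneg.2 h)

theorem abs_apply_le_dual_abs (f : StrongDual ℝ E) (x : E) : |f x| ≤ |f| |x| := by
  have hcone {y : E} (hy : 0 ≤ y) : |f y| ≤ |f| y :=
    abs_le'.2 ⟨le_abs_self f y hy, neg_le_abs f y hy⟩
  calc |f x| = |f x⁺ - f x⁻| := by rw [← map_sub, posPart_sub_negPart]
    _ ≤ |f x⁺| + |f x⁻| := abs_sub _ _
    _ ≤ |f| x⁺ + |f| x⁻ := add_le_add (hcone (posPart_nonneg x)) (hcone (negPart_nonneg x))
    _ = |f| |x| := by rw [← map_add, posPart_add_negPart]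

theorem dual_abs_apply_le (f : StrongDual ℝ E) {x : E} (hx : 0 ≤ x) : |f| x ≤ ‖f‖ * ‖x‖ := by
  change (f + dualPosPart (-f - f)) x ≤ _
  rw [add_apply, dualPosPart_apply _ hx, ← le_sub_iff_add_le']
  refine posVal_le _ hx fun y hy => ?_
  have h : f (x - y - y) ≤ ‖f‖ * ‖x‖ := by
    refine ((le_abs_self _).trans (f.le_opNorm _)).trans
      (mul_le_mul_of_nonneg_left (norm_le_norm_of_abs_le_abs ?_) (norm_nonneg _))
    rw [abs_of_nonneg hx]
    exact abs_le'.2 ⟨(sub_le_self _ hy.1).trans (sub_le_self _ hy.1), by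
      simpa using (sub_le_self y (sub_nonneg.2 hy.2)).trans hy.2⟩
  simp only [map_sub, sub_apply, neg_apply] at h ⊢
  linarith

local instance dual_hasSolidNorm : HasSolidNorm (StrongDual ℝ E) where
  solid f g hfg := f.opNorm_le_bound (norm_nonneg g) fun x => by
    calc ‖f x‖ ≤ |f| |x| := abs_apply_le_dual_abs f x
      _ ≤ |g| |x| := hfg _ (abs_nonneg x)
      _ ≤ ‖g‖ * ‖x‖ := by
        rw [← norm_abs_eq_norm x]
        exact dual_abs_apply_le g (abs_nonneg x)

theorem isWeaklyNull_iff_nonneg {x : ℕ → E} :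
    IsWeaklyNull x ↔ ∀ φ : StrongDual ℝ E, 0 ≤ φ → Tendsto (fun n => φ (x n)) atTop (𝓝 0) := by
  rw [isWeaklyNull_iff]
  refine ⟨fun h φ _ => h φ, fun h φ => ?_⟩
  rw [← posPart_sub_negPart φ]
  simpa only [sub_apply, sub_zero] using (h φ⁺ (posPart_nonneg φ)).sub (h φ⁻ (negPart_nonneg φ))

variable {φ : StrongDual ℝ E} {H : ℕ → StrongDual ℝ E}

theorem sum_abs_apply_le (hH : ∀ n, 0 ≤ H n) (hsum : ∀ s : Finset ℕ, ∑ n ∈ s, H n ≤ φ)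
    (s : Finset ℕ) (y : E) : ∑ n ∈ s, |H n y| ≤ φ |y| :=
  calc ∑ n ∈ s, |H n y| ≤ ∑ n ∈ s, H n |y| := Finset.sum_le_sum fun n _ => by
        simpa only [abs_of_nonneg (hH n)] using abs_apply_le_dual_abs (H n) y
    _ = (∑ n ∈ s, H n) |y| := by rw [sum_apply]
    _ ≤ φ |y| := hsum s _ (abs_nonneg y)

theorem exists_dual_eq_tsum (hH : ∀ n, 0 ≤ H n) (hsum : ∀ s : Finset ℕ, ∑ n ∈ s, H n ≤ φ)
    (S : Set ℕ) : ∃ L : StrongDual ℝ E, ∀ y, L y = ∑' n : S, H n y := by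
  have hsummable (y : E) : Summable fun n => |H n y| :=
    summable_of_sum_le (fun _ => abs_nonneg _) (sum_abs_apply_le hH hsum · y)
  have hsummableS (y : E) : Summable fun n : S => H n y := (hsummable y).of_abs.subtype S
  let L : E →ₗ[ℝ] ℝ :=
    { toFun y := ∑' n : S, H n y
      map_add' y z := by simp only [map_add, (hsummableS y).tsum_add (hsummableS z)]
      map_smul' r y := by simp only [map_smul, smul_eq_mul, tsum_mul_left, RingHom.id_apply] }
  refine ⟨L.mkContinuous ‖φ‖ fun y => ?_, fun y => rfl⟩
  calc ‖∑' n : S, H n y‖ ≤ ∑' n : S, |H n y| :=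
        norm_tsum_le_tsum_norm ((hsummable y).subtype S)
    _ ≤ ∑' n, |H n y| := (hsummable y).tsum_subtype_le _ S (fun _ => abs_nonneg _)
    _ ≤ φ |y| := (hsummable y).tsum_le_of_sum_le (sum_abs_apply_le hH hsum · y)
    _ ≤ ‖φ‖ * ‖|y|‖ := (le_abs_self _).trans (φ.le_opNorm _)
    _ = ‖φ‖ * ‖y‖ := by rw [norm_abs_eq_norm]

theorem tendsto_apply_of_sum_le (hH : ∀ n, 0 ≤ H n) (hsum : ∀ s : Finset ℕ, ∑ n ∈ s, H n ≤ φ)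
    {x : ℕ → E} (hx : IsWeaklyNull x) : Tendsto (fun n => H n (x n)) atTop (𝓝 0) := by
  refine tendsto_diag_of_tendsto_subseries (a := fun n k => H k (x n)) (fun n =>
    summable_of_sum_le (fun _ => norm_nonneg _) (sum_abs_apply_le hH hsum · (x n))) fun S => ?_
  obtain ⟨L, hL⟩ := exists_dual_eq_tsum hH hsum S
  simpa only [hL] using isWeaklyNull_iff.1 hx L

theorem exists_isBandComponent {f : StrongDual ℝ E} (hf : 0 ≤ f) {u : E} (hu : 0 ≤ u) :
    ∃ h, IsBandComponent f u h := by
  have hfmono := monotone_of_dual_nonneg hf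
  have hku (k : ℕ) : 0 ≤ k • u := nsmul_nonneg hu k
  have hbdd (y : E) : BddAbove (Set.range fun k : ℕ => f (y ⊓ k • u)) :=
    ⟨f y, Set.forall_mem_range.2 fun k => hfmono inf_le_left⟩
  have hlim (y : E) : Tendsto (fun k : ℕ => f (y ⊓ k • u)) atTop (𝓝 (⨆ k : ℕ, f (y ⊓ k • u))) :=
    tendsto_atTop_ciSup (fun k l hkl => hfmono (inf_le_inf_left y (nsmul_le_nsmul_left hu hkl)))
      (hbdd y)
  obtain ⟨h, hh⟩ : ∃ h : StrongDual ℝ E, ∀ y, 0 ≤ y → h y = ⨆ k : ℕ, f (y ⊓ k • u) := by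
    refine exists_dual_eq_on_nonneg (c := ‖f‖) (fun y z hy hz => le_antisymm ?_ ?_) (fun y hy => ?_)
      fun y hy => ?_
    · refine le_of_tendsto_of_tendsto' (hlim (y + z)) ((hlim y).add (hlim z)) fun k => ?_
      rw [← map_add]
      exact hfmono (add_inf_le_inf_add_inf hy hz (hku k))
    · refine le_of_tendsto' ((hlim y).add (hlim z)) fun k => ?_
      refine le_trans ?_ (le_ciSup (hbdd (y + z)) (k + k))
      rw [← map_add, add_nsmul]
      exact hfmono (le_inf (add_le_add inf_le_left inf_le_left)
        (add_le_add inf_le_right inf_le_right))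
    · exact ge_of_tendsto' (hlim y) fun k => hf _ (le_inf hy (hku k))
    · exact le_of_tendsto' (hlim y) fun k => apply_le_bound f ⟨le_inf hy (hku k), inf_le_left⟩
  exact ⟨h, fun y hy => hh y hy ▸ hlim y⟩

namespace IsBandComponent

variable {f g h k : StrongDual ℝ E} {u v : E}

theorem nonneg (hh : IsBandComponent f u h) (hf : 0 ≤ f) (hu : 0 ≤ u) : 0 ≤ h := fun y hy =>
  ge_of_tendsto' (hh y hy) fun j => hf _ (le_inf hy (nsmul_nonneg hu j))

theorem le (hh : IsBandComponent f u h) (hf : 0 ≤ f) : h ≤ f := fun y hy =>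
  le_of_tendsto' (hh y hy) fun _ => monotone_of_dual_nonneg hf inf_le_left

theorem inf_eq_zero (hh : IsBandComponent f u h) (hk : IsBandComponent g v k) (hf : 0 ≤ f)
    (hg : 0 ≤ g) (hu : 0 ≤ u) (hv : 0 ≤ v) (huv : u ⊓ v = 0) : h ⊓ k = 0 := by
  refine le_antisymm (fun y hy => ?_) (le_inf (hh.nonneg hf hu) (hk.nonneg hg hv))
  have hlim : Tendsto (fun j : ℕ => k y - g (y ⊓ j • v)) atTop (𝓝 0) := by
    simpa only [sub_self] using (hk y hy).const_sub (k y)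
  refine ge_of_tendsto' hlim fun j => ?_
  have hz : 0 ≤ y ⊓ j • v := le_inf hy (nsmul_nonneg hv j)
  have huz : u ⊓ (y ⊓ j • v) = 0 := by
    have huj : u ⊓ j • v = 0 := by simpa using nsmul_inf_nsmul_eq_zero hu hv huv 1 j
    rw [inf_left_comm, huj, inf_eq_right.2 hy]
  calc (h ⊓ k) y = (h ⊓ k) (y ⊓ j • v) + (h ⊓ k) (y - y ⊓ j • v) := by
        rw [← map_add, add_sub_cancel]
    _ ≤ h (y ⊓ j • v) + k (y - y ⊓ j • v) :=
        add_le_add ((inf_le_left : h ⊓ k ≤ h) _ hz)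
          ((inf_le_right : h ⊓ k ≤ k) _ (sub_nonneg.2 inf_le_left))
    _ = k y - g (y ⊓ j • v) := by
        rw [hh.apply_eq_zero hu hz huz, map_sub,
          hk.apply_eq_of_le_nsmul hv hz inf_le_right, zero_add]

theorem sum_le {H : ℕ → StrongDual ℝ E} {w : ℕ → E} (hH : ∀ n, IsBandComponent f (w n) (H n))
    (hf : 0 ≤ f) (hw : ∀ n, 0 ≤ w n) (hd : ∀ m n, m ≠ n → w m ⊓ w n = 0) (s : Finset ℕ) :
    ∑ n ∈ s, H n ≤ f := by
  intro y hy
  rw [sum_apply]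
  refine le_of_tendsto' (tendsto_finsetSum s fun n _ => hH n y hy) fun k => ?_
  rw [← map_sum]
  have hy_inf (n : ℕ) : 0 ≤ y ⊓ k • w n := le_inf hy (nsmul_nonneg (hw n) k)
  refine monotone_of_dual_nonneg hf (sum_le_of_pairwise_inf_eq_zero hy
    (fun n _ => ⟨hy_inf n, inf_le_left⟩) fun m _ n _ hmn => ?_)
  refine le_antisymm ?_ (le_inf (hy_inf m) (hy_inf n))
  exact (inf_le_inf inf_le_right inf_le_right).trans_eq
    (nsmul_inf_nsmul_eq_zero (hw m) (hw n) (hd m n hmn) k k)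

end IsBandComponent

theorem isWeaklyNull_of_disjoint_of_le_posPart {f w : ℕ → E} (hf : IsWeaklyNull f)
    (hw : ∀ n, 0 ≤ w n) (hd : ∀ m n, m ≠ n → w m ⊓ w n = 0) (hle : ∀ n, w n ≤ (f n)⁺) :
    IsWeaklyNull w := by
  refine isWeaklyNull_iff_nonneg.2 fun φ hφ => ?_
  choose H hH using fun n => exists_isBandComponent hφ (hw n)
  have hHpos (n : ℕ) : 0 ≤ H n := (hH n).nonneg hφ (hw n)
  have hHf : Tendsto (fun n => H n (f n)) atTop (𝓝 0) :=
    tendsto_apply_of_sum_le hHpos (IsBandComponent.sum_le hH hφ hw hd) hf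
  refine squeeze_zero (fun n => hφ _ (hw n)) (fun n => ?_) hHf
  have hdisj : w n ⊓ (f n)⁻ = 0 := le_antisymm
    ((inf_le_inf_right _ (hle n)).trans_eq (posPart_inf_negPart_eq_zero (f n)))
    (le_inf (hw n) (negPart_nonneg _))
  calc φ (w n) = H n (w n) :=
        ((hH n).apply_eq_of_le_nsmul (hw n) (hw n) (one_nsmul (w n)).ge).symm
    _ ≤ H n (f n)⁺ := monotone_of_dual_nonneg (hHpos n) (hle n)
    _ = H n (f n)⁺ - H n (f n)⁻ := by
        rw [(hH n).apply_eq_zero (hw n) (negPart_nonneg _) hdisj, sub_zero]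
    _ = H n (f n) := by rw [← map_sub, posPart_sub_negPart]

theorem exists_disjoint_weaklyNull_apply_eq_posPart {f : ℕ → StrongDual ℝ E}
    (hf : IsWeaklyNull f) {x : ℕ → E} (hx : IsDisjointSeq x) :
    ∃ w : ℕ → StrongDual ℝ E, IsPositiveDualSeq w ∧ IsDisjointDualSeq w ∧ IsWeaklyNull w ∧
      ∀ n, w n (x n) = (f n)⁺ (x n) := by
  have hpos (n : ℕ) : 0 ≤ (f n)⁺ := posPart_nonneg (f n)
  choose w hw using fun n => exists_isBandComponent (hpos n) (abs_nonneg (x n))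
  have hw0 (n : ℕ) : 0 ≤ w n := (hw n).nonneg (hpos n) (abs_nonneg _)
  have hd (m n : ℕ) (hmn : m ≠ n) : w m ⊓ w n = 0 :=
    (hw m).inf_eq_zero (hw n) (hpos m) (hpos n) (abs_nonneg _) (abs_nonneg _) (hx m n hmn)
  refine ⟨w, hw0, fun m n hmn => ?_, ?_, fun n => (hw n).apply_eq_of_abs⟩
  · rw [abs_of_nonneg (hw0 m), abs_of_nonneg (hw0 n)]
    exact hd m n hmn
  · exact isWeaklyNull_of_disjoint_of_le_posPart hf hw0 hd fun n => (hw n).le (hpos n)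

theorem tendsto_apply_of_forall_positive_disjoint {x : ℕ → E} (hx : IsDisjointSeq x)
    (h : ∀ w : ℕ → StrongDual ℝ E, IsPositiveDualSeq w → IsDisjointDualSeq w → IsWeaklyNull w →
      Tendsto (fun n => w n (x n)) atTop (𝓝 0))
    {f : ℕ → StrongDual ℝ E} (hf : IsWeaklyNull f) :
    Tendsto (fun n => f n (x n)) atTop (𝓝 0) := by
  have hpos {g : ℕ → StrongDual ℝ E} (hg : IsWeaklyNull g) :
      Tendsto (fun n => (g n)⁺ (x n)) atTop (𝓝 0) := by
    obtain ⟨w, hw0, hwd, hw, hwx⟩ := exists_disjoint_weaklyNull_apply_eq_posPart hg hx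
    simpa only [hwx] using h w hw0 hwd hw
  have hdiff (n : ℕ) : f n (x n) = (f n)⁺ (x n) - ((-f) n)⁺ (x n) := by
    rw [Pi.neg_apply, posPart_neg, ← sub_apply, posPart_sub_negPart]
  simpa only [hdiff, sub_zero] using (hpos hf).sub (hpos hf.neg)

end DualLattice

end BanachLattice

theorem theorem2p2_general {E : Type*} [NormedAddCommGroup E] [Lattice E] [HasSolidNorm E]
    [IsOrderedAddMonoid E] [NormedSpace ℝ E] (p : ℝ) (hp : 0 < p) :
    List.TFAE [
      BanachLattice.HasDisjointDPP E p,
      ∀ x : ℕ → E, BanachLattice.IsDisjointSeq x → BanachLattice.IsWeaklyPSummable p x →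
        BanachLattice.IsAlmostDunfordPettisSet (Set.range x),
      ∀ x : ℕ → E, BanachLattice.IsDisjointSeq x → BanachLattice.IsWeaklyPSummable p x →
        ∀ f : ℕ → StrongDual ℝ E, BanachLattice.IsDisjointDualSeq f →
          BanachLattice.IsWeaklyNull f → Filter.Tendsto (fun n => f n (x n)) Filter.atTop (nhds 0),
      ∀ x : ℕ → E, BanachLattice.IsDisjointSeq x → BanachLattice.IsWeaklyPSummable p x →
        ∀ f : ℕ → StrongDual ℝ E, BanachLattice.IsPositiveDualSeq f →
          BanachLattice.IsDisjointDualSeq f → BanachLattice.IsWeaklyNull f →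
            Filter.Tendsto (fun n => f n (x n)) Filter.atTop (nhds 0),
      ∀ x : ℕ → E, BanachLattice.IsDisjointSeq x → BanachLattice.IsWeaklyPSummable p x →
        ∀ f : ℕ → StrongDual ℝ E, BanachLattice.IsPositiveDualSeq f →
          BanachLattice.IsWeaklyNull f →
            Filter.Tendsto (fun n => f n (x n)) Filter.atTop (nhds 0)] := by
  tfae_have 1 → 2 := fun h x hx hxp => ⟨hxp.isBounded_range hp, fun f _ hf => h x hx hxp f hf⟩
  tfae_have 2 → 3 := fun h x hx hxp f hfd hf =>
    BanachLattice.tendsto_diag_of_tendstoUniformlyOn_range ((h x hx hxp).2 f hfd hf)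
  tfae_have 3 → 4 := fun h x hx hxp f _ hfd hf => h x hx hxp f hfd hf
  tfae_have 1 → 5 := fun h x hx hxp f _ hf =>
    BanachLattice.tendsto_diag_of_tendstoUniformlyOn_range (h x hx hxp f hf)
  tfae_have 5 → 4 := fun h x hx hxp f hf0 _ hf => h x hx hxp f hf0 hf
  tfae_have 4 → 1 := fun h x hx hxp f hf =>
    BanachLattice.tendstoUniformlyOn_range_of_tendsto_diag (fun m => hf.tendsto_apply (x m))
      fun n m hn hm => BanachLattice.tendsto_apply_of_forall_positive_disjoint
        (hx.comp hm.injective) (h _ (hx.comp hm.injective) (hxp.comp hm.injective))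
        (hf.comp hn.tendsto_atTop)
  tfae_finish

theorem theorem2p2 {E : Type*} [NormedAddCommGroup E] [Lattice E] [HasSolidNorm E]
    [IsOrderedAddMonoid E] [NormedSpace ℝ E] [IsOrderedModule ℝ E] [CompleteSpace E]
    (p : ℝ) (hp : 1 ≤ p) :
    List.TFAE [
      BanachLattice.HasDisjointDPP E p,
      ∀ x : ℕ → E, BanachLattice.IsDisjointSeq x → BanachLattice.IsWeaklyPSummable p x →
        BanachLattice.IsAlmostDunfordPettisSet (Set.range x),
      ∀ x : ℕ → E, BanachLattice.IsDisjointSeq x → BanachLattice.IsWeaklyPSummable p x →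
        ∀ f : ℕ → StrongDual ℝ E, BanachLattice.IsDisjointDualSeq f →
          BanachLattice.IsWeaklyNull f → Filter.Tendsto (fun n => f n (x n)) Filter.atTop (nhds 0),
      ∀ x : ℕ → E, BanachLattice.IsDisjointSeq x → BanachLattice.IsWeaklyPSummable p x →
        ∀ f : ℕ → StrongDual ℝ E, BanachLattice.IsPositiveDualSeq f →
          BanachLattice.IsDisjointDualSeq f → BanachLattice.IsWeaklyNull f →
            Filter.Tendsto (fun n => f n (x n)) Filter.atTop (nhds 0),
      ∀ x : ℕ → E, BanachLattice.IsDisjointSeq x → BanachLattice.IsWeaklyPSummable p x →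
        ∀ f : ℕ → StrongDual ℝ E, BanachLattice.IsPositiveDualSeq f →
          BanachLattice.IsWeaklyNull f →
            Filter.Tendsto (fun n => f n (x n)) Filter.atTop (nhds 0)] :=
  theorem2p2_general p (zero_lt_one.trans_le hp)
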